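/- Let $f:[0,1]\to[0,1]$ be the Farey map, $f(x)=\frac{x}{1-x}$ for $0\le x\le\frac12$ and $f(x)=\frac{1-x}{x}$ for $\frac12\le x\le 1$. For $\beta\in\mathbb{R}$ let $$\zeta(z,\beta)=\exp\sum_{n=1}^{\infty}\frac{z^n}{n}\sum_{x\in[0,1],\,f^n(x)=x}\exp\Big(-\beta\sum_{k=0}^{n-1}\log|f'(f^k(x))|\Big)$$ be its Ruelle zeta function, regarded as a power series in $z$ about $0$ (for every $n\ge1$ the inner sum is finite, and the derivative at $0$ is one-sided), let $\rho(\beta)\in[0,\infty]$ be the radius of convergence of this power series, and let $P(\beta)=-\log\rho(\beta)$ be the pressure function. Then: 1. $0\le P(\beta)<\infty$ for every $\beta\in\mathbb{R}$; 2. $P$ is monotonically nonincreasing on $\mathbb{R}$; 3. $P(\beta)=0$ for every $\beta\ge 1$. -/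

import Mathlib

namespace Farey

/-- The unit interval `I = [0,1]`. -/
def I : Set ℝ := Set.Icc 0 1

/-- The Farey map: `x / (1 - x)` on `[0,1/2]` and `(1 - x) / x` on `[1/2,1]`.
Only its values on the unit interval are ever used. -/
noncomputable def map (x : ℝ) : ℝ :=
  if x ≤ 1 / 2 then x / (1 - x) else (1 - x) / x

/-- The fixed points in `I` of the `n`-th iterate of the Farey map. -/
def fixedPts (n : ℕ) : Set ℝ := {x | x ∈ I ∧ map^[n] x = x}

/-- The interaction `φ(x) = -β log |f'(x)|`. The derivative is that of `f` as a map on `I`,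
so it is one-sided at the fixed point `0`. The points `1/2` (where `f` has a corner) and `1`
are not periodic, so that their interaction never matters. -/
noncomputable def interaction (β x : ℝ) : ℝ :=
  -β * Real.log |derivWithin map I x|

/-- The sum `∑_{fⁿ(x) = x} exp ∑_{k<n} φ(fᵏ x)`; it is a finite sum for `n ≥ 1`,
see `fixedPts_finite`. -/
noncomputable def periodicSum (β : ℝ) (n : ℕ) : ℝ :=
  ∑ᶠ x ∈ fixedPts n, Real.exp (∑ k ∈ Finset.range n, interaction β (map^[k] x))

/-- The power series `∑_{n ≥ 1} (zⁿ / n) ∑_{fⁿ(x) = x} exp ∑_{k<n} φ(fᵏ x)`. -/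
noncomputable def logZeta (β : ℝ) : PowerSeries ℝ :=
  PowerSeries.mk fun n => if n = 0 then 0 else periodicSum β n / n

/-- The Ruelle zeta function of the Farey map, as a power series in `z`: the exponential of
`logZeta β` (substitution of a series without constant term into the exponential series). -/
noncomputable def zeta (β : ℝ) : PowerSeries ℝ :=
  (PowerSeries.exp ℝ).subst (logZeta β)

/-- The radius of convergence, in the complex variable `z`, of the power series of the
zeta function about `0`. -/
noncomputable def zetaRadius (β : ℝ) : ENNReal :=
  (FormalMultilinearSeries.ofScalars ℂ
    fun n => ((PowerSeries.coeff n (zeta β) : ℝ) : ℂ)).radius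

/-- The pressure function: minus the logarithm of the radius of convergence of the zeta
function, an extended real number (`⊤` for radius `0`, `⊥` for infinite radius). -/
noncomputable def pressure (β : ℝ) : EReal := -ENNReal.log (zetaRadius β)

theorem map_mem {x : ℝ} (hx : x ∈ I) : map x ∈ I := by
  obtain ⟨h0, h1⟩ := hx
  unfold map I
  split_ifs with h
  · exact ⟨div_nonneg h0 (by linarith), by rw [div_le_one (by linarith)]; linarith⟩
  · push Not at h
    exact ⟨div_nonneg (by linarith) (by linarith), by rw [div_le_one (by linarith)]; linarith⟩

theorem iterate_mem {x : ℝ} (hx : x ∈ I) (n : ℕ) : map^[n] x ∈ I := by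
  induction n with
  | zero => exact hx
  | succ n ih => rw [Function.iterate_succ_apply']; exact map_mem ih

/-- Distinct points of the same branch are strictly separated. -/
theorem map_expand {x y : ℝ} (hx : x ∈ I) (hy : y ∈ I) (hxy : x ≠ y)
    (hb : x ≤ 1 / 2 ↔ y ≤ 1 / 2) : |x - y| < |map x - map y| := by
  obtain ⟨hx0, hx1⟩ := hx
  obtain ⟨hy0, hy1⟩ := hy
  have hpos : 0 < |x - y| := abs_pos.mpr (sub_ne_zero.mpr hxy)
  unfold map
  by_cases h : x ≤ 1 / 2
  · have h' := hb.mp h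
    have e : x / (1 - x) - y / (1 - y) = (x - y) / ((1 - x) * (1 - y)) := by
      have : 1 - x ≠ 0 := by linarith
      have : 1 - y ≠ 0 := by linarith
      field_simp
      ring
    have hp : 0 < (1 - x) * (1 - y) := mul_pos (by linarith) (by linarith)
    have hl : (1 - x) * (1 - y) < 1 := by
      rcases lt_or_gt_of_ne hxy with g | g <;> nlinarith
    rw [if_pos h, if_pos h', e, abs_div, abs_of_pos hp, lt_div_iff₀ hp]
    nlinarith
  · have h' : ¬ y ≤ 1 / 2 := fun g => h (hb.mpr g)
    rw [if_neg h, if_neg h']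
    push Not at h h'
    have e : (1 - x) / x - (1 - y) / y = (y - x) / (x * y) := by
      have : x ≠ 0 := by linarith
      have : y ≠ 0 := by linarith
      field_simp
      ring
    have hp : 0 < x * y := mul_pos (by linarith) (by linarith)
    have hl : x * y < 1 := by
      rcases lt_or_gt_of_ne hxy with g | g <;> nlinarith
    rw [e, abs_div, abs_of_pos hp, lt_div_iff₀ hp, abs_sub_comm y x]
    nlinarith

/-- Two points of `I` whose first `n` iterates lie on the same branches are separated. -/
theorem iterate_expand {x y : ℝ} (hx : x ∈ I) (hy : y ∈ I) (hxy : x ≠ y) (n : ℕ)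
    (hb : ∀ k < n + 1, (map^[k] x ≤ 1 / 2 ↔ map^[k] y ≤ 1 / 2)) :
    |x - y| < |map^[n + 1] x - map^[n + 1] y| := by
  induction n with
  | zero => simpa using map_expand hx hy hxy (hb 0 (by omega))
  | succ n ih =>
    have h1 := ih fun k hk => hb k (by omega)
    rw [Function.iterate_succ_apply' map (n + 1) x, Function.iterate_succ_apply' map (n + 1) y]
    refine h1.trans (map_expand (iterate_mem hx _) (iterate_mem hy _) ?_ (hb (n + 1) (by omega)))
    intro he
    rw [he, sub_self, abs_zero] at h1
    exact absurd h1 (not_lt.mpr (abs_nonneg _))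

theorem fixedPts_finite {n : ℕ} (hn : n ≠ 0) : (fixedPts n).Finite := by
  obtain ⟨m, rfl⟩ := Nat.exists_eq_succ_of_ne_zero hn
  refine Set.Finite.of_injOn (f := fun x (k : Fin (m + 1)) => (map^[(k : ℕ)] x ≤ 1 / 2 : Prop))
    (t := Set.univ) (fun _ _ => Set.mem_univ _) ?_ Set.finite_univ
  rintro x ⟨hx, fx⟩ y ⟨hy, fy⟩ he
  by_contra hxy
  have h := iterate_expand hx hy hxy m fun k hk => iff_of_eq (congrFun he ⟨k, hk⟩)
  rw [Nat.succ_eq_add_one] at fx fy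
  rw [fx, fy] at h
  exact lt_irrefl _ h

theorem hasSubst_logZeta (β : ℝ) : PowerSeries.HasSubst (logZeta β) :=
  PowerSeries.HasSubst.of_constantCoeff_zero' (by
    rw [← PowerSeries.coeff_zero_eq_constantCoeff_apply, logZeta, PowerSeries.coeff_mk, if_pos rfl])

end Farey

/-!
Write `Z_n` for `periodicSum β n` and `b_n` for the coefficients of the zeta function, so that
`n b_n = ∑_{k=1}^n Z_k b_{n-k}` (`coeff_zeta_succ`). All `Z_k` are positive, hence the `b_n` are
positive and increase with the `Z_k`, and everything reduces to estimates on the `Z_k`.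

* The fixed point `0` has derivative `1`, so `Z_n ≥ 1`; this forces `b_n ≥ 1`, and the radius of
  convergence is at most `1`, i.e. the pressure is nonnegative.
* The derivative is at least `1` in absolute value, so `Z_n` is nonincreasing in `β`, and the
  radius is nondecreasing.
* At `β = 1` one has `Z_n ≤ n + 1` (`periodicSum_one_le`). The inverse branches of the `n`-th
  iterate are Möbius maps, each containing at most one fixed point in its image; the images tile
  the interval, so their lengths add up to `1`, and the distortion of a branch, the ratio of the
  weight of the fixed point to the length, is at most `n + 1` because each step increases the
  ratio `c / d` in the denominator `c y + d` by at most one (`sum_exp_neg_logDeriv_le`). As the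
  derivative lies between `1` and `4`, it follows that `Z_n ≤ (n + 1) 4 ^ (n max (1 - β) 0)`.
  The recursion turns this into a lower bound for the radius (`coeff_zeta_mul_pow_bounded`), that
  is, into `P(β) ≤ max (1 - β) 0 * log 4` (`pressure_le`), which is finite, and `0` for `β ≥ 1`.
-/

namespace Farey

/-! ### The derivative of the Farey map along periodic orbits -/

theorem uniqueDiffOn_I : UniqueDiffOn ℝ I := uniqueDiffOn_Icc zero_lt_one

theorem abs_derivWithin_map_of_lt {x : ℝ} (hx : x ∈ I) (h : x < 1 / 2) :
    |derivWithin map I x| = ((1 - x) ^ 2)⁻¹ := by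
  have hne : 1 - x ≠ 0 := by linarith
  have hd : HasDerivAt (fun y : ℝ => y / (1 - y)) ((1 - x) ^ 2)⁻¹ x := by
    refine ((hasDerivAt_id' x).div ((hasDerivAt_id' x).const_sub 1) hne).congr_deriv ?_
    field_simp
    ring
  have he : map =ᶠ[nhds x] fun y => y / (1 - y) := by
    filter_upwards [Iio_mem_nhds h] with y hy
    exact if_pos (le_of_lt hy)
  rw [(hd.congr_of_eventuallyEq he).hasDerivWithinAt.derivWithin
    (uniqueDiffOn_I x hx), abs_of_nonneg (by positivity)]

theorem abs_derivWithin_map_of_gt {x : ℝ} (hx : x ∈ I) (h : 1 / 2 < x) :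
    |derivWithin map I x| = (x ^ 2)⁻¹ := by
  have hne : x ≠ 0 := by linarith
  have hd : HasDerivAt (fun y : ℝ => (1 - y) / y) (-(x ^ 2)⁻¹) x := by
    refine (((hasDerivAt_id' x).const_sub 1).div (hasDerivAt_id' x) hne).congr_deriv ?_
    field_simp
    ring
  have he : map =ᶠ[nhds x] fun y => (1 - y) / y := by
    filter_upwards [Ioi_mem_nhds h] with y hy
    exact if_neg (not_le_of_gt hy)
  rw [(hd.congr_of_eventuallyEq he).hasDerivWithinAt.derivWithin
    (uniqueDiffOn_I x hx), abs_neg, abs_of_nonneg (by positivity)]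

theorem abs_derivWithin_map_bounds {x : ℝ} (hx : x ∈ I) (h : x ≠ 1 / 2) :
    1 ≤ |derivWithin map I x| ∧ |derivWithin map I x| ≤ 4 := by
  have key : ∀ t : ℝ, 1 / 2 < t → t ≤ 1 → 1 ≤ (t ^ 2)⁻¹ ∧ (t ^ 2)⁻¹ ≤ 4 := fun t h₁ h₂ =>
    ⟨(one_le_inv₀ (by positivity)).2 (by nlinarith),
      inv_le_of_inv_le₀ (by norm_num) (by nlinarith)⟩
  rcases lt_or_gt_of_ne h with h | h
  · rw [abs_derivWithin_map_of_lt hx h]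
    exact key _ (by linarith) (by linarith [hx.1])
  · rw [abs_derivWithin_map_of_gt hx h]
    exact key _ h hx.2

theorem map_zero : map 0 = 0 := by norm_num [map]

theorem iterate_map_zero (n : ℕ) : map^[n] 0 = 0 :=
  Function.iterate_fixed map_zero n

/-- The orbit of a periodic point avoids the corner `1/2`, which is mapped to the fixed
point `0` in two steps. -/
theorem iterate_ne_half {n : ℕ} (hn : n ≠ 0) {x : ℝ} (hx : x ∈ fixedPts n) (k : ℕ) :
    map^[k] x ≠ 1 / 2 := by
  intro h
  have h2 : map^[k + 2] x = 0 := by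
    rw [add_comm, Function.iterate_add_apply, h]
    norm_num [map]
  have h0 : x = 0 := by
    have hp : map^[n * (k + 2)] x = x := by
      rw [Function.iterate_mul]
      exact Function.iterate_fixed hx.2 _
    obtain ⟨m, hm⟩ := Nat.exists_eq_add_of_le
      (Nat.le_mul_of_pos_left (k + 2) (Nat.pos_of_ne_zero hn))
    rw [hm, add_comm, Function.iterate_add_apply, h2, iterate_map_zero] at hp
    exact hp.symm
  rw [h0, iterate_map_zero] at h
  norm_num at h

/-- The logarithm of the absolute derivative of the `n`-th iterate of the Farey map, as the sum
of the logarithms of the derivative along the orbit. -/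
noncomputable def logDeriv (n : ℕ) (x : ℝ) : ℝ :=
  ∑ k ∈ Finset.range n, Real.log |derivWithin map I (map^[k] x)|

theorem logDeriv_succ (n : ℕ) (x : ℝ) :
    logDeriv (n + 1) x = Real.log |derivWithin map I x| + logDeriv n (map x) := by
  simp only [logDeriv, Finset.sum_range_succ', Function.iterate_succ_apply,
    Function.iterate_zero_apply, add_comm]

theorem logDeriv_zero_right (n : ℕ) : logDeriv n 0 = 0 := by
  refine Finset.sum_eq_zero fun k _ => ?_
  rw [iterate_map_zero, abs_derivWithin_map_of_lt (by norm_num [I]) (by norm_num)]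
  norm_num

theorem logDeriv_nonneg {n : ℕ} (hn : n ≠ 0) {x : ℝ} (hx : x ∈ fixedPts n) :
    0 ≤ logDeriv n x :=
  Finset.sum_nonneg fun k _ => Real.log_nonneg
    (abs_derivWithin_map_bounds (iterate_mem hx.1 k) (iterate_ne_half hn hx k)).1

theorem logDeriv_le {n : ℕ} (hn : n ≠ 0) {x : ℝ} (hx : x ∈ fixedPts n) :
    logDeriv n x ≤ n * Real.log 4 := by
  have h : ∀ k ∈ Finset.range n,
      Real.log |derivWithin map I (map^[k] x)| ≤ Real.log 4 := fun k _ => by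
    obtain ⟨h₁, h₂⟩ :=
      abs_derivWithin_map_bounds (iterate_mem hx.1 k) (iterate_ne_half hn hx k)
    exact Real.log_le_log (by linarith) h₂
  simpa [logDeriv] using Finset.sum_le_sum h

theorem periodicSum_eq {n : ℕ} (hn : n ≠ 0) (β : ℝ) :
    periodicSum β n = ∑ x ∈ (fixedPts_finite hn).toFinset, Real.exp (-β * logDeriv n x) := by
  rw [periodicSum, finsum_mem_eq_finite_toFinset_sum _ (fixedPts_finite hn)]
  simp only [interaction, logDeriv, Finset.mul_sum]

/-- The fixed point `0` has derivative `1`, so it contributes `1` to every periodic sum. -/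
theorem one_le_periodicSum {n : ℕ} (hn : n ≠ 0) (β : ℝ) : 1 ≤ periodicSum β n := by
  rw [periodicSum_eq hn]
  have h0 : (0 : ℝ) ∈ (fixedPts_finite hn).toFinset := by
    simpa using ⟨by norm_num [I], iterate_map_zero n⟩
  simpa [logDeriv_zero_right] using Finset.single_le_sum
    (f := fun x => Real.exp (-β * logDeriv n x)) (fun x _ => (Real.exp_pos _).le) h0

theorem periodicSum_antitone {n : ℕ} (hn : n ≠ 0) : Antitone fun β => periodicSum β n := by
  intro β γ h
  simp only [periodicSum_eq hn]
  refine Finset.sum_le_sum fun x hx => Real.exp_le_exp.2 ?_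
  have := logDeriv_nonneg hn ((fixedPts_finite hn).mem_toFinset.1 hx)
  nlinarith

/-! ### Polynomial growth of the periodic sums at `β = 1` -/

/-- The inverse branches of the `n`-th iterate are Möbius maps with determinant `±1`, and a
denominator `c y + d` turns into `(c + d) y + d` or `d y + (c + d)` under composition with
`y ↦ y / (1 + y)` or `y ↦ 1 / (1 + y)`. The function `1 / (d (c + d))`, the length of the image
of `I`, is additive under this splitting, whereas `c / d`, which controls the distortion, grows
by at most one. Hence points with distinct itineraries satisfy the bound. -/
theorem sum_exp_neg_logDeriv_le {ι : Type*} (n : ℕ) :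
    ∀ (m c d : ℝ), 0 ≤ m → 0 ≤ c → 0 < d → c ≤ m * d → ∀ (S : Finset ι) (q : ι → ℝ),
      (∀ i ∈ S, q i ∈ I) → (∀ i ∈ S, ∀ k < n, map^[k] (q i) ≠ 1 / 2) →
      (∀ i ∈ S, ∀ j ∈ S,
        (∀ k < n, (map^[k] (q i) ≤ 1 / 2 ↔ map^[k] (q j) ≤ 1 / 2)) → i = j) →
      ∑ i ∈ S, Real.exp (-logDeriv n (q i)) / (c * q i + d) ^ 2
        ≤ (m + n + 1) / (d * (c + d)) := by
  induction n with
  | zero =>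
    intro m c d hm hc hd hcd S q hI _ hinj
    have hpos : 0 ≤ (m + (0 : ℕ) + 1) / (d * (c + d)) := by positivity
    rcases S.eq_empty_or_nonempty with rfl | ⟨i, hi⟩
    · simpa using hpos
    have hS : S = {i} := Finset.eq_singleton_iff_unique_mem.2
      ⟨hi, fun j hj => hinj j hj i hi fun k hk => absurd hk (Nat.not_lt_zero k)⟩
    have hq := mul_nonneg hc (hI i hi).1
    rw [hS, Finset.sum_singleton, logDeriv, Finset.sum_range_zero, neg_zero, Real.exp_zero,
      div_le_div_iff₀ (by positivity) (by positivity)]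
    push_cast
    have h1 : d ^ 2 ≤ (c * q i + d) ^ 2 := by gcongr; linarith
    nlinarith
  | succ n ih =>
    intro m c d hm hc hd hcd S q hI hne hinj
    -- On each branch the summand for `(c, d)` at `x` is the one for the child at `map x`.
    have hl : ∀ i ∈ S.filter (fun i => q i ≤ 1 / 2),
        Real.exp (-logDeriv (n + 1) (q i)) / (c * q i + d) ^ 2
          = Real.exp (-logDeriv n (map (q i))) / ((c + d) * map (q i) + d) ^ 2 := by
      intro i hi
      obtain ⟨hi, hb⟩ := Finset.mem_filter.1 hi
      have hlt : q i < 1 / 2 := lt_of_le_of_ne hb (hne i hi 0 (Nat.succ_pos n))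
      have hx := hI i hi
      have h1 : 0 < 1 - q i := by linarith
      have h2 : 0 < c * q i + d := by have := mul_nonneg hc hx.1; linarith
      have e : (c + d) * map (q i) + d = (c * q i + d) / (1 - q i) := by
        rw [map, if_pos hb]
        field_simp
        ring
      rw [e, logDeriv_succ, neg_add, Real.exp_add, abs_derivWithin_map_of_lt hx hlt, Real.log_inv,
        neg_neg, Real.exp_log (by positivity)]
      field_simp
    have hr : ∀ i ∈ S.filter (fun i => ¬ q i ≤ 1 / 2),
        Real.exp (-logDeriv (n + 1) (q i)) / (c * q i + d) ^ 2
          = Real.exp (-logDeriv n (map (q i))) / (d * map (q i) + (c + d)) ^ 2 := by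
      intro i hi
      obtain ⟨hi, hb⟩ := Finset.mem_filter.1 hi
      have hlt : 1 / 2 < q i := not_le.1 hb
      have hx := hI i hi
      have h1 : 0 < q i := by linarith
      have h2 : 0 < c * q i + d := by have := mul_nonneg hc hx.1; linarith
      have e : d * map (q i) + (c + d) = (c * q i + d) / q i := by
        rw [map, if_neg hb]
        field_simp
        ring
      rw [e, logDeriv_succ, neg_add, Real.exp_add, abs_derivWithin_map_of_gt hx hlt, Real.log_inv,
        neg_neg, Real.exp_log (by positivity)]
      field_simp
    have hI' : ∀ i ∈ S, map (q i) ∈ I := fun i hi => map_mem (hI i hi)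
    have hne' : ∀ i ∈ S, ∀ k < n, map^[k] (map (q i)) ≠ 1 / 2 := fun i hi k hk => by
      rw [← Function.iterate_succ_apply]
      exact hne i hi (k + 1) (by omega)
    have hinj' : ∀ i ∈ S, ∀ j ∈ S, (q i ≤ 1 / 2 ↔ q j ≤ 1 / 2) →
        (∀ k < n, (map^[k] (map (q i)) ≤ 1 / 2 ↔ map^[k] (map (q j)) ≤ 1 / 2)) → i = j := by
      intro i hi j hj h0 h
      refine hinj i hi j hj fun k hk => ?_
      cases k with
      | zero => exact h0
      | succ k => exact h k (by omega)
    rw [← Finset.sum_filter_add_sum_filter_not S (fun i => q i ≤ 1 / 2), Finset.sum_congr rfl hl,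
      Finset.sum_congr rfl hr]
    have h₁ := ih (m + 1) (c + d) d (by linarith) (by linarith) hd (by linarith)
      (S.filter fun i => q i ≤ 1 / 2) (fun i => map (q i))
      (fun i hi => hI' i (Finset.mem_filter.1 hi).1)
      (fun i hi => hne' i (Finset.mem_filter.1 hi).1)
      (fun i hi j hj => hinj' i (Finset.mem_filter.1 hi).1 j (Finset.mem_filter.1 hj).1
        (iff_of_true (Finset.mem_filter.1 hi).2 (Finset.mem_filter.1 hj).2))
    have h₂ := ih (m + 1) d (c + d) (by linarith) hd.le (by linarith) (by nlinarith)
      (S.filter fun i => ¬ q i ≤ 1 / 2) (fun i => map (q i))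
      (fun i hi => hI' i (Finset.mem_filter.1 hi).1)
      (fun i hi => hne' i (Finset.mem_filter.1 hi).1)
      (fun i hi j hj => hinj' i (Finset.mem_filter.1 hi).1 j (Finset.mem_filter.1 hj).1
        (iff_of_false (Finset.mem_filter.1 hi).2 (Finset.mem_filter.1 hj).2))
    refine (add_le_add h₁ h₂).trans_eq ?_
    push_cast
    field_simp
    ring

theorem periodicSum_one_le {n : ℕ} (hn : n ≠ 0) : periodicSum 1 n ≤ n + 1 := by
  rw [periodicSum_eq hn]
  have h := sum_exp_neg_logDeriv_le n 0 0 1 le_rfl le_rfl one_pos (by norm_num)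
    (fixedPts_finite hn).toFinset id
    (fun x hx => ((fixedPts_finite hn).mem_toFinset.1 hx).1)
    (fun x hx k _ => iterate_ne_half hn ((fixedPts_finite hn).mem_toFinset.1 hx) k) ?_
  · simpa using h
  · -- Two fixed points of the iterate with the same itinerary coincide by expansion.
    intro x hx y hy hb
    obtain ⟨hxI, fx⟩ := (fixedPts_finite hn).mem_toFinset.1 hx
    obtain ⟨hyI, fy⟩ := (fixedPts_finite hn).mem_toFinset.1 hy
    obtain ⟨l, rfl⟩ := Nat.exists_eq_succ_of_ne_zero hn
    by_contra hxy
    have h := iterate_expand hxI hyI hxy l hb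
    rw [Nat.succ_eq_add_one] at fx fy
    rw [fx, fy] at h
    exact lt_irrefl _ h

/-- Passing from exponent `1` to `β < 1` costs a factor `|(fⁿ)'| ^ (1 - β) ≤ 4 ^ ((1 - β) n)`;
for `β ≥ 1` it costs nothing. -/
theorem periodicSum_le {n : ℕ} (hn : n ≠ 0) (β : ℝ) :
    periodicSum β n ≤ (n + 1) * Real.exp (max (1 - β) 0 * Real.log 4) ^ n := by
  set s := max (1 - β) 0
  have hs : 0 ≤ s := le_max_right _ _
  have hβ : 1 - β ≤ s := le_max_left _ _
  refine le_trans ?_ (mul_le_mul_of_nonneg_right (periodicSum_one_le hn) (by positivity))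
  rw [periodicSum_eq hn, periodicSum_eq hn, Finset.sum_mul]
  refine Finset.sum_le_sum fun x hx => ?_
  have hx := (fixedPts_finite hn).mem_toFinset.1 hx
  rw [← Real.exp_nat_mul, ← Real.exp_add]
  refine Real.exp_le_exp.2 ?_
  have h₁ := mul_le_mul_of_nonneg_right hβ (logDeriv_nonneg hn hx)
  have h₂ := mul_le_mul_of_nonneg_left (logDeriv_le hn hx) hs
  linarith

/-! ### The coefficients of the zeta function -/

theorem coeff_zero_zeta (β : ℝ) : PowerSeries.coeff 0 (zeta β) = 1 := by
  have h0 : PowerSeries.constantCoeff (logZeta β) = 0 := by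
    rw [← PowerSeries.coeff_zero_eq_constantCoeff_apply, logZeta, PowerSeries.coeff_mk, if_pos rfl]
  rw [zeta, PowerSeries.coeff_subst' (hasSubst_logZeta β), finsum_eq_single _ 0]
  · simp
  · intro d hd
    simp [h0, hd]

/-- The recursion for the coefficients of an exponential, from the differential equation
`ζ' = (log ζ)' ζ`. -/
theorem coeff_zeta_succ (β : ℝ) (n : ℕ) :
    (n + 1) * PowerSeries.coeff (n + 1) (zeta β)
      = ∑ k ∈ Finset.range (n + 1),
          periodicSum β (k + 1) * PowerSeries.coeff (n - k) (zeta β) := by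
  have h : PowerSeries.derivative ℝ (zeta β)
      = PowerSeries.derivative ℝ (logZeta β) * zeta β := by
    rw [zeta, PowerSeries.derivative_subst (hasSubst_logZeta β), PowerSeries.derivative_exp,
      mul_comm]
  have hc := congrArg (PowerSeries.coeff n) h
  rw [PowerSeries.coeff_derivative, PowerSeries.coeff_mul,
    Finset.Nat.sum_antidiagonal_eq_sum_range_succ_mk] at hc
  rw [mul_comm, hc]
  refine Finset.sum_congr rfl fun k _ => ?_
  rw [PowerSeries.coeff_derivative, logZeta, PowerSeries.coeff_mk, if_neg (Nat.succ_ne_zero k)]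
  push_cast
  field_simp

theorem one_le_coeff_zeta (β : ℝ) (n : ℕ) : 1 ≤ PowerSeries.coeff n (zeta β) := by
  induction n using Nat.strong_induction_on with
  | _ n ih =>
    cases n with
    | zero => rw [coeff_zero_zeta]
    | succ n =>
      have h : ∑ _k ∈ Finset.range (n + 1), (1 : ℝ)
          ≤ (n + 1) * PowerSeries.coeff (n + 1) (zeta β) := by
        rw [coeff_zeta_succ]
        exact Finset.sum_le_sum fun k _ => one_le_mul_of_one_le_of_one_le
          (one_le_periodicSum (Nat.succ_ne_zero k) β) (ih _ (by omega))
      rw [Finset.sum_const, Finset.card_range, nsmul_eq_mul, mul_one, Nat.cast_succ] at h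
      exact (le_mul_iff_one_le_right (by positivity)).1 h

theorem coeff_zeta_antitone (n : ℕ) : Antitone fun β => PowerSeries.coeff n (zeta β) := by
  intro β γ hβγ
  induction n using Nat.strong_induction_on with
  | _ n ih =>
    cases n with
    | zero => simp only [coeff_zero_zeta, le_refl]
    | succ n =>
      refine le_of_mul_le_mul_left ?_ (by positivity : (0 : ℝ) < n + 1)
      rw [coeff_zeta_succ, coeff_zeta_succ]
      refine Finset.sum_le_sum fun k _ => mul_le_mul
        (periodicSum_antitone (Nat.succ_ne_zero k) hβγ) (ih _ (by omega)) ?_ ?_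
      · exact zero_le_one.trans (one_le_coeff_zeta γ _)
      · exact zero_le_one.trans (one_le_periodicSum (Nat.succ_ne_zero k) β)

/-- If `∑ Z_k t^k` converges, then the terms `b_n t^n` of the zeta function are bounded: the
recursion gives `n b_n t^n ≤ (∑ Z_k t^k) max_{j < n} b_j t^j`, so the maximum stops growing once
`n` exceeds the sum. -/
theorem coeff_zeta_mul_pow_bounded (β : ℝ) {t : ℝ} (ht : 0 ≤ t)
    (hs : Summable fun k => periodicSum β (k + 1) * t ^ (k + 1)) :
    ∃ C, ∀ n, PowerSeries.coeff n (zeta β) * t ^ n ≤ C := by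
  have hb (n : ℕ) : 0 ≤ PowerSeries.coeff n (zeta β) := zero_le_one.trans (one_le_coeff_zeta β n)
  have hZ (k : ℕ) : 0 ≤ periodicSum β (k + 1) * t ^ (k + 1) :=
    mul_nonneg (zero_le_one.trans (one_le_periodicSum (Nat.succ_ne_zero k) β)) (by positivity)
  set K := ∑' k, periodicSum β (k + 1) * t ^ (k + 1)
  obtain ⟨N, hN⟩ := exists_nat_ge K
  refine ⟨∑ j ∈ Finset.range (N + 1), PowerSeries.coeff j (zeta β) * t ^ j, fun n => ?_⟩
  set C := ∑ j ∈ Finset.range (N + 1), PowerSeries.coeff j (zeta β) * t ^ j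
  have hC : 0 ≤ C := Finset.sum_nonneg fun j _ => mul_nonneg (hb j) (by positivity)
  induction n using Nat.strong_induction_on with
  | _ n ih =>
    by_cases hn : n ≤ N
    · exact Finset.single_le_sum (f := fun j => PowerSeries.coeff j (zeta β) * t ^ j)
        (fun j _ => mul_nonneg (hb j) (by positivity)) (Finset.mem_range.2 (by omega))
    obtain ⟨m, rfl⟩ := Nat.exists_eq_succ_of_ne_zero (show n ≠ 0 by omega)
    refine le_of_mul_le_mul_left ?_ (by positivity : (0 : ℝ) < m + 1)
    calc (m + 1) * (PowerSeries.coeff (m + 1) (zeta β) * t ^ (m + 1))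
        = ∑ k ∈ Finset.range (m + 1), periodicSum β (k + 1) * t ^ (k + 1)
            * (PowerSeries.coeff (m - k) (zeta β) * t ^ (m - k)) := by
          rw [← mul_assoc, coeff_zeta_succ, Finset.sum_mul]
          refine Finset.sum_congr rfl fun k hk => ?_
          have : m + 1 = (k + 1) + (m - k) := by have := Finset.mem_range.1 hk; omega
          rw [this, pow_add]
          ring
      _ ≤ ∑ k ∈ Finset.range (m + 1), periodicSum β (k + 1) * t ^ (k + 1) * C :=
          Finset.sum_le_sum fun k _ => mul_le_mul_of_nonneg_left (ih _ (by omega)) (hZ k)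
      _ ≤ K * C := by
          rw [← Finset.sum_mul]
          exact mul_le_mul_of_nonneg_right (hs.sum_le_tsum _ fun k _ => hZ k) hC
      _ ≤ (m + 1) * C := by
          refine mul_le_mul_of_nonneg_right (hN.trans ?_) hC
          exact_mod_cast (not_le.1 hn).le

/-! ### The radius of convergence -/

theorem norm_ofScalars_zeta (β : ℝ) (n : ℕ) :
    ‖FormalMultilinearSeries.ofScalars ℂ
      (fun n => ((PowerSeries.coeff n (zeta β) : ℝ) : ℂ)) n‖ = PowerSeries.coeff n (zeta β) := by
  rw [FormalMultilinearSeries.ofScalars_norm, Complex.norm_real,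
    Real.norm_of_nonneg (zero_le_one.trans (one_le_coeff_zeta β n))]

theorem zetaRadius_le_one (β : ℝ) : zetaRadius β ≤ 1 := by
  by_contra! h
  obtain ⟨a, ⟨ha0, ha1⟩, C, -, hC⟩ :=
    FormalMultilinearSeries.norm_mul_pow_le_mul_pow_of_lt_radius _
      (show ((1 : NNReal) : ENNReal) < _ from h)
  have hle (n : ℕ) : 1 ≤ C * a ^ n := by
    have := hC n
    rw [norm_ofScalars_zeta, NNReal.coe_one, one_pow, mul_one] at this
    exact (one_le_coeff_zeta β n).trans this
  have hlim := (tendsto_pow_atTop_nhds_zero_of_lt_one ha0.le ha1).const_mul C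
  rw [mul_zero] at hlim
  exact absurd (ge_of_tendsto' hlim hle) (by norm_num)

theorem zetaRadius_monotone : Monotone zetaRadius := fun β γ h =>
  FormalMultilinearSeries.radius_le_of_le fun n => by
    rw [norm_ofScalars_zeta, norm_ofScalars_zeta]
    exact coeff_zeta_antitone n h

/-- The bound `(n + 1) qⁿ` on the periodic sums, with `q = 4 ^ max (1 - β) 0`, gives the lower
bound `1 / q` on the radius. -/
theorem le_zetaRadius (β : ℝ) :
    ENNReal.ofReal (Real.exp (-(max (1 - β) 0 * Real.log 4))) ≤ zetaRadius β := by
  refine ENNReal.le_of_forall_nnreal_lt fun r hr => ?_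
  set q := Real.exp (max (1 - β) 0 * Real.log 4) with hq
  have hq0 : 0 < q := Real.exp_pos _
  have hqr : q * r < 1 := by
    rw [← ENNReal.ofReal_coe_nnreal, ENNReal.ofReal_lt_ofReal_iff (Real.exp_pos _), Real.exp_neg,
      ← hq] at hr
    have := mul_lt_mul_of_pos_left hr hq0
    rwa [mul_inv_cancel₀ hq0.ne'] at this
  have hs : Summable fun k : ℕ => ((k : ℝ) + 1) * (q * r) ^ k := by
    have hn : ‖q * r‖ < 1 := by rwa [Real.norm_of_nonneg (by positivity)]
    simpa [add_mul] using (summable_pow_mul_geometric_of_norm_lt_one 1 hn).add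
      (summable_geometric_of_norm_lt_one hn)
  obtain ⟨C, hC⟩ := coeff_zeta_mul_pow_bounded β r.coe_nonneg
    (((summable_nat_add_iff 1).2 hs).of_nonneg_of_le
      (fun k => mul_nonneg (zero_le_one.trans (one_le_periodicSum (Nat.succ_ne_zero k) β))
        (by positivity))
      fun k => by
        rw [mul_pow, ← mul_assoc]
        exact mul_le_mul_of_nonneg_right (periodicSum_le (Nat.succ_ne_zero k) β) (by positivity))
  refine FormalMultilinearSeries.le_radius_of_bound _ C fun n => ?_
  rw [norm_ofScalars_zeta]
  exact hC n

/-! ### The pressure -/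

theorem pressure_nonneg (β : ℝ) : 0 ≤ pressure β :=
  EReal.neg_nonneg.2 (ENNReal.log_le_zero_iff.2 (zetaRadius_le_one β))

theorem pressure_antitone : Antitone pressure := fun _ _ h =>
  EReal.neg_le_neg_iff.2 (ENNReal.log_le_log (zetaRadius_monotone h))

theorem pressure_le (β : ℝ) : pressure β ≤ (max (1 - β) 0 * Real.log 4 : ℝ) := by
  have h := ENNReal.log_le_log (le_zetaRadius β)
  rw [ENNReal.log_ofReal_of_pos (Real.exp_pos _), Real.log_exp, EReal.coe_neg] at h
  exact EReal.neg_le_of_neg_le h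

end Farey

theorem mainTheorem7 :
    (∀ β : ℝ, 0 ≤ Farey.pressure β ∧ Farey.pressure β ≠ ⊤) ∧
      Antitone Farey.pressure ∧
      (∀ β : ℝ, 1 ≤ β → Farey.pressure β = 0) := by
  refine ⟨fun β => ⟨Farey.pressure_nonneg β, ?_⟩, Farey.pressure_antitone, fun β hβ => ?_⟩
  · exact ((Farey.pressure_le β).trans_lt (EReal.coe_lt_top _)).ne
  · refine le_antisymm ((Farey.pressure_le β).trans_eq ?_) (Farey.pressure_nonneg β)
    rw [max_eq_right (by linarith), zero_mul, EReal.coe_zero]
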